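/- Let $K$ be a field and let $(Q,\sigma)$ be a finite rooted tree quiver, i.e. a finite directed graph whose underlying graph is a tree and which has a unique sink $\sigma$. A representation of $Q$ assigns a finite-dimensional $K$-vector space to each vertex and a linear map to each arrow. For each vertex $x$ let $L_Q(x)$ be the finite distributive lattice defined recursively by $L_Q(x)=\prod_{a\colon y\to x} J(L_Q(y))$, the product being over all arrows $a$ with head $x$, where $J(A)$ is the lattice of order ideals (down-sets, including $\emptyset$) of $A$ ordered by inclusion; if no arrow ends at $x$, then $L_Q(x)$ has one element. For $M=(M_a)_a\in L_Q(x)$ let $c_M\colon Q_M\to Q$ be the rooted tree quiver over $Q$, with root $\sigma_M$ lying over $x$, obtained recursively by taking, for every arrow $a\colon y\to x$ and every maximal element $S$ of the ideal $M_a\subseteq L_Q(y)$, the quiver $Q_S$ extended by a new sink along one new arrow from its root, lying over $a$, and then gluing all these quivers at their new sinks. For a rooted tree quiver $Q'$ with root $\sigma'$ and a representation $W$ of $Q'$, let $\operatorname{rank}_{Q'}W$ be the image at $\sigma'$ of the composition $\mathcal E(W)\hookrightarrow W\twoheadrightarrow \mathcal I(W)$, where $\mathcal E(W)$ is the largest subrepresentation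 of $W$ all of whose arrow maps are surjective and $\mathcal I(W)$ is the largest quotient of $W$ all of whose arrow maps are injective. For $M\in L_Q(x)$ and a representation $V$ of $Q$ put $\operatorname{rank}_M V=\operatorname{rank}_{Q_M}(c_M^*V)$, where $(c_M^*V)_z=V_{c_M(z)}$ for vertices $z$ and $(c_M^*V)_b=V_{c_M(b)}$ for arrows $b$, and let $r_M(V)=\dim_K \operatorname{rank}_M V$. Let $\mathbb 1_M=c_{M*}\mathbb 1_{Q_M}$ be the reduced representation, where $\mathbb 1_{Q_M}$ has $K$ at every vertex and the identity along every arrow, and $(c_{M*}W)_z=\bigoplus_{c_M(u)=z}W_u$, $(c_{M*}W)_a=\sum_{c_M(b)=a}W_b$. Then for every vertex $x$ of $Q$ and all $M,N\in L_Q(x)$, $$r_M(\mathbb 1_N)=\zeta(M,N)=\begin{cases}1 & \text{if } M\le N,\\ 0 & \text{otherwise,}\end{cases}$$ where $\zeta$ is the zeta function of the lattice $L_Q(x)$. -/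

import Mathlib

universe k u v w w'

/-! ### Rooted tree quivers -/

/-- A rooted tree quiver with root `σ`: the underlying (multi)graph is a tree, i.e. it has neither
loops nor multiple edges (in either direction) and is a tree as a simple graph, and `σ` is the
unique sink. -/
structure IsRootedTree {V : Type u} [Quiver.{v} V] (σ : V) : Prop where
  /-- There are no parallel arrows. -/
  subsingleton_hom : ∀ x y : V, Subsingleton (x ⟶ y)
  /-- There are no pairs of opposite arrows; in particular (`x = y`) there are no loops. -/
  isEmpty_hom : ∀ x y : V, Nonempty (x ⟶ y) → IsEmpty (y ⟶ x)
  /-- The underlying simple graph is a tree. -/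
  isTree : (SimpleGraph.fromRel fun x y : V => Nonempty (x ⟶ y)).IsTree
  /-- The root is the only vertex without outgoing arrows. -/
  sink_iff : ∀ x : V, (∀ y : V, IsEmpty (x ⟶ y)) ↔ x = σ

/-- `ArrowRel y x` means that there is an arrow from `y` to `x`. -/
def ArrowRel {V : Type u} [Quiver.{v} V] (y x : V) : Prop := Nonempty (y ⟶ x)

namespace IsRootedTree

variable {V : Type u} [Quiver.{v} V] {σ : V}

/-- A rooted tree quiver has no directed cycles. -/
theorem not_transGen_self (hQ : IsRootedTree σ) (x : V) : ¬ Relation.TransGen ArrowRel x x := by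
  intro h
  obtain ⟨y, hxy, hyx⟩ := Relation.TransGen.head'_iff.1 h
  have hne : x ≠ y := by
    rintro rfl
    exact (hQ.isEmpty_hom x x hxy).elim hxy.some
  have hadj : (SimpleGraph.fromRel fun x y : V => Nonempty (x ⟶ y)).Adj x y :=
    (SimpleGraph.fromRel_adj _ _ _).2 ⟨hne, Or.inl hxy⟩
  have hb := SimpleGraph.isAcyclic_iff_forall_adj_isBridge.1 hQ.isTree.isAcyclic hadj
  rw [SimpleGraph.isBridge_iff] at hb
  refine hb ?_
  set G := (SimpleGraph.fromRel fun x y : V => Nonempty (x ⟶ y)) with hG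
  have key : ∀ z, Relation.ReflTransGen ArrowRel y z →
      (G \ SimpleGraph.fromEdgeSet {s(x, y)}).Reachable y z ∨
      (G \ SimpleGraph.fromEdgeSet {s(x, y)}).Reachable y x := by
    intro z hz
    induction hz with
    | refl => exact Or.inl (SimpleGraph.Reachable.refl _)
    | @tail b c _ hbc ih =>
      rcases ih with ih | ih
      · by_cases hbx : b = x
        · exact Or.inr (hbx ▸ ih)
        · refine Or.inl (ih.trans (SimpleGraph.Adj.reachable ?_))
          have hbc' : b ≠ c := by
            rintro rfl
            exact (hQ.isEmpty_hom b b hbc).elim hbc.some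
          refine ⟨(SimpleGraph.fromRel_adj _ _ _).2 ⟨hbc', Or.inl hbc⟩, ?_⟩
          rintro ⟨h1, -⟩
          rcases Sym2.eq_iff.1 h1 with ⟨h2, -⟩ | ⟨h2, h3⟩
          · exact hbx h2
          · subst h2 h3
            exact (hQ.isEmpty_hom _ _ hxy).elim hbc.some
      · exact Or.inr ih
  rcases key x hyx with h | h <;> exact h.symm

/-- The arrows of a finite rooted tree quiver form a well-founded relation. -/
theorem acc [Finite V] (hQ : IsRootedTree σ) (x : V) : Acc ArrowRel x := by
  have : Std.Irrefl (Relation.TransGen (ArrowRel (V := V))) := ⟨hQ.not_transGen_self⟩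
  have : IsTrans V (Relation.TransGen (ArrowRel (V := V))) := ⟨fun _ _ _ => Relation.TransGen.trans⟩
  exact Subrelation.accessible (r := Relation.TransGen ArrowRel)
    (fun h => Relation.TransGen.single h) ((Finite.wellFounded_of_trans_of_irrefl _).apply x)

end IsRootedTree

/-! ### Representations of quivers -/

/-- A finite dimensional representation over `K` of the quiver `V`. -/
structure QuiverRep (K : Type k) [Field K] (V : Type u) [Quiver.{v} V] where
  /-- The vector space at a vertex. -/
  obj : V → Type w
  [addCommGroup : ∀ x, AddCommGroup (obj x)]
  [module : ∀ x, Module K (obj x)]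
  [finiteDimensional : ∀ x, FiniteDimensional K (obj x)]
  /-- The linear map along an arrow. -/
  map : ∀ {x y : V}, (x ⟶ y) → (obj x →ₗ[K] obj y)

attribute [instance] QuiverRep.addCommGroup QuiverRep.module QuiverRep.finiteDimensional

namespace QuiverRep

section

variable {K : Type k} [Field K] {V : Type u} [Quiver.{v} V]

variable (K V) in
/-- The representation `𝟙_Q`, with `K` at each vertex and the identity map along each arrow. -/
def one : QuiverRep.{k, u, v, k} K V where
  obj _ := K
  map _ := LinearMap.id

/-- A subrepresentation: a subspace at each vertex, mapped into each other along arrows. -/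
structure Subrep (W : QuiverRep.{k, u, v, w} K V) where
  /-- The subspace at a vertex. -/
  space : ∀ x, Submodule K (W.obj x)
  map_le : ∀ {x y : V} (a : x ⟶ y), (space x).map (W.map a) ≤ space y

/-- A subrepresentation is epimorphic if its maps along all arrows are surjective. -/
def Subrep.IsEpimorphic {W : QuiverRep.{k, u, v, w} K V} (E : W.Subrep) : Prop :=
  ∀ {x y : V} (a : x ⟶ y), (E.space x).map (W.map a) = E.space y

/-- The quotient of `W` by the subrepresentation `N` is monomorphic, that is, the maps
`W x ⧸ N x → W y ⧸ N y` induced along the arrows are all injective. -/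
def Subrep.IsMonomorphicQuotient {W : QuiverRep.{k, u, v, w} K V} (N : W.Subrep) : Prop :=
  ∀ {x y : V} (a : x ⟶ y), Function.Injective
    ((N.space x).mapQ (N.space y) (W.map a) (Submodule.map_le_iff_le_comap.1 (N.map_le a)))

/-- The value at `x` of the largest epimorphic subrepresentation of `W`. -/
def epiPart (W : QuiverRep.{k, u, v, w} K V) (x : V) : Submodule K (W.obj x) :=
  ⨆ (E : W.Subrep) (_ : E.IsEpimorphic), E.space x

/-- The value at `x` of the smallest subrepresentation with monomorphic quotient, that is, of the
kernel of the projection from `W` to its largest monomorphic quotient. -/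
def monoKer (W : QuiverRep.{k, u, v, w} K V) (x : V) : Submodule K (W.obj x) :=
  ⨅ (N : W.Subrep) (_ : N.IsMonomorphicQuotient), N.space x

/-- The global rank functor at the vertex `x`: the image of the largest epimorphic
subrepresentation in the largest monomorphic quotient. -/
def globalRank (W : QuiverRep.{k, u, v, w} K V) (x : V) : Submodule K (W.obj x ⧸ W.monoKer x) :=
  (W.epiPart x).map (W.monoKer x).mkQ

end

section

variable {K : Type k} [Field K] {V' : Type u} [Quiver.{v} V'] {V : Type w} [Quiver.{w'} V]

/-- The pullback `f^* W` along a map of directed graphs. -/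
def pullback.{r} (f : V' ⥤q V) (W : QuiverRep.{k, w, w', r} K V) : QuiverRep.{k, u, v, r} K V' where
  obj x := W.obj (f.obj x)
  map a := W.map (f.map a)

open Classical in
/-- The pushforward `f_* W` along a map of directed graphs with finite domain:
`(f_* W)_x = ⨁_{f u = x} W_u` (as a finite product) and `(f_* W)_a = ∑_{f b = a} W_b`. -/
noncomputable def pushforward.{r} [Finite V'] [∀ u v : V', Finite (u ⟶ v)] (f : V' ⥤q V)
    (W : QuiverRep.{k, u, v, r} K V') : QuiverRep.{k, w, w', max u r} K V where
  obj x := ∀ u : {u : V' // f.obj u = x}, W.obj u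
  map {x y} a :=
    LinearMap.pi fun t : {t : V' // f.obj t = y} =>
      letI := Fintype.ofFinite
        (Σ s : {s : V' // f.obj s = x}, {b : s.1 ⟶ t.1 // (f.map b).cast s.2 t.2 = a})
      ∑ b : (Σ s : {s : V' // f.obj s = x}, {b : s.1 ⟶ t.1 // (f.map b).cast s.2 t.2 = a}),
        W.map b.2.1 ∘ₗ LinearMap.proj b.1

end

end QuiverRep

/-! ### The lattices -/

section Lattice

variable {V : Type u} [Quiver.{v} V] [Finite V] [∀ x y : V, Finite (x ⟶ y)]

/-- The product `∏ J (L y)` over all arrows `y ⟶ x` of the lattices of order ideals in given finite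
distributive lattices `L y`. -/
noncomputable def idealProduct (x : V) (L : ∀ y : V, (y ⟶ x) → FinBddDistLat.{max u v}) :
    FinBddDistLat.{max u v} :=
  haveI : Finite (∀ (y : V) (a : y ⟶ x), LowerSet (L y a)) := inferInstance
  @FinBddDistLat.of (∀ (y : V) (a : y ⟶ x), LowerSet (L y a)) _ _ (Fintype.ofFinite _)

/-- The lattice at the vertex `x`, by recursion along arrows: the product, over all arrows `a`
with head `x`, of the lattice `J (L y)` of order ideals in the lattice `L y` at the tail `y` of `a`.
Removing `x` from the quiver of all vertices with a path to `x` leaves one component for each such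
arrow `a`, namely the quiver of all vertices with a path to `y`. -/
noncomputable def treeLattice {x : V} (h : Acc ArrowRel x) : FinBddDistLat.{max u v} :=
  Acc.rec (motive := fun _ _ => FinBddDistLat.{max u v})
    (fun x _ L => idealProduct x fun y a => L y ⟨a⟩) h

end Lattice

/-! ### Quivers over a quiver -/

/-- A finite quiver over `V` with a root lying over `x`. -/
structure RootedOver {V : Type u} [Quiver.{v} V] (x : V) where
  /-- The vertices. -/
  Vert : Type w
  [quiver : Quiver.{w} Vert]
  [finite_vert : Finite Vert]
  [finite_hom : ∀ s t : Vert, Finite (s ⟶ t)]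
  /-- The root. -/
  root : Vert
  /-- The structure map. -/
  str : Vert ⥤q V
  str_root : str.obj root = x

attribute [instance] RootedOver.quiver RootedOver.finite_vert RootedOver.finite_hom

namespace RootedOver

variable {V : Type u} [Quiver.{v} V] {x : V} {ι : Type w} {y : ι → V}

/-- The vertices of the quiver obtained from a family `T` by extending each `T i` by one new sink
and gluing the results at these sinks: `none` is the common sink. -/
def GraftVert (T : ∀ i, RootedOver.{u, v, w} (y i)) : Type w := Option (Σ i, (T i).Vert)

/-- The arrows of this quiver: the arrows of all `T i`, and one arrow from the root of each `T i`
to the common sink. -/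
inductive GraftHom (T : ∀ i, RootedOver.{u, v, w} (y i)) : GraftVert T → GraftVert T → Type w
  | inner {i : ι} {s t : (T i).Vert} (b : s ⟶ t) : GraftHom T (some ⟨i, s⟩) (some ⟨i, t⟩)
  | ext (i : ι) : GraftHom T (some ⟨i, (T i).root⟩) none

instance (T : ∀ i, RootedOver.{u, v, w} (y i)) : Quiver.{w} (GraftVert T) := ⟨GraftHom T⟩

instance (T : ∀ i, RootedOver.{u, v, w} (y i)) [Finite ι] : Finite (GraftVert T) :=
  inferInstanceAs (Finite (Option (Σ i, (T i).Vert)))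

instance (T : ∀ i, RootedOver.{u, v, w} (y i)) [Finite ι] (s t : GraftVert T) :
    Finite (s ⟶ t) := by
  let φ : (s ⟶ t) → Option (Σ i, Σ p : (T i).Vert × (T i).Vert, (p.1 ⟶ p.2)) := fun e =>
    match e with
    | GraftHom.inner (i := i) (s := s) (t := t) b => some ⟨i, (s, t), b⟩
    | GraftHom.ext _ => none
  refine Finite.of_injective φ ?_
  rintro (@⟨i, s, t, b⟩ | i) e'
  · rcases e' with @⟨_, _, _, b'⟩
    intro h
    have hb : b = b' := by simpa [φ] using h
    rw [hb]
  · rcases e'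
    intro _
    rfl

/-- The structure map of this quiver, given arrows `a i : y i ⟶ x`: the new arrow at `T i` lies
over `a i`. -/
def graftStr (T : ∀ i, RootedOver.{u, v, w} (y i)) (a : ∀ i, y i ⟶ x) : GraftVert T ⥤q V where
  obj p := match p with
    | none => x
    | some ⟨i, s⟩ => (T i).str.obj s
  map e := match e with
    | GraftHom.inner (i := i) b => (T i).str.map b
    | GraftHom.ext i => (a i).cast (T i).str_root.symm rfl

/-- Extend each `T i` along the arrow `a i : y i ⟶ x`, and glue the results at their sinks. -/
def graft [Finite ι] (T : ∀ i, RootedOver.{u, v, w} (y i)) (a : ∀ i, y i ⟶ x) :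
    RootedOver.{u, v, w} x where
  Vert := GraftVert T
  root := none
  str := graftStr T a
  str_root := rfl

end RootedOver

/-! ### Reduced quivers, reduced representations, rank functions -/

section Reduced

variable {V : Type u} [Quiver.{v} V] [Finite V] [∀ x y : V, Finite (x ⟶ y)]

/-- The reduced quiver `Q_M` over `Q` for `M` in the lattice at `x`: for each arrow `a : y ⟶ x` and
each maximal element `S` of the order ideal `M y a`, extend `Q_S` along `a`, and glue all of
these at their sinks. -/
noncomputable def treeReduced {x : V} (h : Acc ArrowRel x) :
    treeLattice h → RootedOver.{u, v, max u v} x :=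
  Acc.rec (motive := fun x h => treeLattice h → RootedOver.{u, v, max u v} x)
    (fun x h R (M : ∀ (y : V) (a : y ⟶ x), LowerSet (treeLattice (h y ⟨a⟩))) =>
      RootedOver.graft
        (ι := Σ y : V, Σ a : y ⟶ x, {S : treeLattice (h y ⟨a⟩) // Maximal (· ∈ M y a) S})
        (fun i => R i.1 ⟨i.2.1⟩ i.2.2.1) (fun i => i.2.1)) h

namespace IsRootedTree

variable {σ : V}

/-- The lattice `L_{Q, x}` at a vertex `x` of a rooted tree quiver. -/
noncomputable abbrev latt (hQ : IsRootedTree σ) (x : V) : FinBddDistLat.{max u v} := treeLattice (hQ.acc x)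

/-- The lattice `L_{Q, x}` is the product of the lattices `J (L_{Q, y})` over all arrows
`y ⟶ x`. -/
theorem latt_eq (hQ : IsRootedTree σ) (x : V) :
    hQ.latt x = idealProduct x fun y _ => hQ.latt y := by
  unfold latt
  generalize hQ.acc x = h
  cases h
  rfl

noncomputable instance (hQ : IsRootedTree σ) (x : V) : DecidableLE (hQ.latt x) :=
  Classical.decRel _

/-- The reduced quiver `Q_M` over `Q`, with its root and its structure map `c_M`. -/
noncomputable abbrev reduced (hQ : IsRootedTree σ) {x : V} (M : hQ.latt x) :
    RootedOver.{u, v, max u v} x :=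
  treeReduced (hQ.acc x) M

/-- The reduced representation `c_{M*} 𝟙_{Q_M}` of `Q`. -/
noncomputable def reducedRep (K : Type k) [Field K] (hQ : IsRootedTree σ) {x : V}
    (M : hQ.latt x) : QuiverRep.{k, u, v, max u v k} K V :=
  QuiverRep.pushforward (hQ.reduced M).str (QuiverRep.one K (hQ.reduced M).Vert)

/-- The rank space `rank_M W`: the global rank functor of `Q_M` (at its root), applied to the
pullback of `W` along `c_M`. -/
noncomputable def rankSpace {K : Type k} [Field K] (hQ : IsRootedTree σ) {x : V} (M : hQ.latt x)
    (W : QuiverRep.{k, u, v, w} K V) :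
    Submodule K ((W.pullback (hQ.reduced M).str).obj (hQ.reduced M).root ⧸
      (W.pullback (hQ.reduced M).str).monoKer (hQ.reduced M).root) :=
  (W.pullback (hQ.reduced M).str).globalRank (hQ.reduced M).root

/-- The rank function `r_M W = dim rank_M W`. -/
noncomputable def rankFunction {K : Type k} [Field K] (hQ : IsRootedTree σ) {x : V}
    (M : hQ.latt x) (W : QuiverRep.{k, u, v, w} K V) : ℕ :=
  Module.finrank K (hQ.rankSpace M W)

end IsRootedTree

end Reduced

/-! All arrows of `Q_M` point towards its root, so a subspace at the root pulls back to a
subrepresentation with monomorphic quotient. Applied to `0`, this kills `monoKer` at the root, and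
`r_M` is the dimension of the epimorphic part there. As `Q` has no directed cycles, only the root of
`Q_N` lies over `x`; hence `𝟙_N` is one-dimensional at `x`, and the value is 0 or 1.

If `M ≤ N`, there is a morphism `Q_M → Q_N` over `Q` (`nonempty_morphism_treeReduced`), and the
basis vectors of its image span an epimorphic subrepresentation of the pullback. Conversely, the
supports of vectors in an epimorphic subrepresentation that is nonzero at the root define a
simulation of `Q_M` by `Q_N` relating the roots, and such a simulation forces `M ≤ N`
(`le_of_isSimulation_treeReduced`). -/

/-! ### Structure of grafted quivers -/

namespace RootedOver

variable {V : Type u} [Quiver.{v} V] {x : V}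

theorem graftStr_map_ext_heq {ι : Type w} {y : ι → V} (T : ∀ i, RootedOver.{u, v, w} (y i))
    (a : ∀ i, y i ⟶ x) (i : ι) :
    (graftStr T a).map (X := some ⟨i, (T i).root⟩) (Y := none) (GraftHom.ext i) ≍ a i := by
  change (a i).cast (T i).str_root.symm rfl ≍ a i
  exact Quiver.Hom.cast_heq _ _ _

/-- Every vertex has at most one outgoing arrow, and the root has none. -/
structure IsForestTowardsRoot (A : RootedOver.{u, v, w} x) : Prop where
  isEmpty_root_hom : ∀ t : A.Vert, IsEmpty (A.root ⟶ t)
  subsingleton_out : ∀ s : A.Vert, Subsingleton (Σ t : A.Vert, s ⟶ t)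

/-- The condition on the root carries the induction: grafting adds an arrow out of the root of each
`T i`, which must be its only one. -/
theorem IsForestTowardsRoot.graft {ι : Type w} [Finite ι] {y : ι → V}
    (T : ∀ i, RootedOver.{u, v, w} (y i)) (a : ∀ i, y i ⟶ x)
    (hT : ∀ i, (T i).IsForestTowardsRoot) : (RootedOver.graft T a).IsForestTowardsRoot where
  isEmpty_root_hom t := ⟨fun e => nomatch (show GraftHom T none t from e)⟩
  subsingleton_out s := by
    refine ⟨?_⟩
    rintro ⟨t, e⟩ ⟨t', e'⟩
    change GraftHom T s t at e
    change GraftHom T s t' at e'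
    cases e with
    | @inner i s t b =>
      cases e' with
      | @inner _ _ t' b' =>
        have h := @Subsingleton.elim _ ((hT i).subsingleton_out s) ⟨t, b⟩ ⟨t', b'⟩
        cases h
        rfl
      | ext => exact (((hT i).isEmpty_root_hom t).false b).elim
    | ext i =>
      cases e' with
      | @inner _ _ t' b' => exact (((hT i).isEmpty_root_hom t').false b').elim
      | ext => rfl

/-- Every vertex other than the root lies over a vertex with a nontrivial path to `x`. -/
def LiesOverPaths (A : RootedOver.{u, v, w} x) : Prop :=
  ∀ s : A.Vert, s = A.root ∨ Relation.TransGen ArrowRel (A.str.obj s) x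

theorem LiesOverPaths.graft {ι : Type w} [Finite ι] {y : ι → V}
    (T : ∀ i, RootedOver.{u, v, w} (y i)) (a : ∀ i, y i ⟶ x)
    (hT : ∀ i, (T i).LiesOverPaths) : (RootedOver.graft T a).LiesOverPaths := by
  rintro (_ | ⟨i, s⟩)
  · exact Or.inl rfl
  · right
    have hi : ArrowRel (y i) x := ⟨a i⟩
    change Relation.TransGen ArrowRel ((T i).str.obj s) x
    rcases hT i s with rfl | h
    · rw [(T i).str_root]
      exact .single hi
    · exact h.tail hi

/-- Every subspace at the root extends to a subrepresentation with monomorphic quotient. -/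
def ExtendsSubspaces (K : Type k) [Field K] (A : RootedOver.{u, v, w} x) : Prop :=
  ∀ (W : QuiverRep.{k, w, w, w'} K A.Vert) (U : Submodule K (W.obj A.root)),
    ∃ N : ∀ s, Submodule K (W.obj s), N A.root = U ∧
      ∀ {s t : A.Vert} (b : s ⟶ t), (N t).comap (W.map b) = N s

/-- Pull `U` back along each new arrow to the root of `T i`, then extend within each `T i`
separately; the branches do not interact. -/
theorem ExtendsSubspaces.graft (K : Type k) [Field K] {ι : Type w} [Finite ι] {y : ι → V}
    (T : ∀ i, RootedOver.{u, v, w} (y i)) (a : ∀ i, y i ⟶ x)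
    (hT : ∀ i, ExtendsSubspaces.{k, u, v, w, w'} K (T i)) :
    ExtendsSubspaces.{k, u, v, w, w'} K (RootedOver.graft T a) := by
  intro W U
  let ℓ : ∀ i, (T i).Vert ⥤q GraftVert T := fun i => ⟨fun s => some ⟨i, s⟩, fun b => .inner b⟩
  have hex := fun i => hT i (W.pullback (ℓ i))
    (U.comap (W.map (x := (some ⟨i, (T i).root⟩ : GraftVert T))
      (y := (RootedOver.graft T a).root) (GraftHom.ext i)))
  choose N hroot hN using hex
  refine ⟨fun s => match s with
    | none => U
    | some ⟨i, s⟩ => N i s, rfl, ?_⟩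
  intro s t b
  change GraftHom T s t at b
  cases b with
  | inner b => exact hN _ b
  | ext i => exact (hroot i).symm

end RootedOver

section Reduced

variable {V : Type u} [Quiver.{v} V] [Finite V] [∀ x y : V, Finite (x ⟶ y)]

/-- A property preserved by grafting holds for all reduced quivers. -/
theorem treeReduced_induction {P : ∀ {x : V}, RootedOver.{u, v, max u v} x → Prop}
    (graft : ∀ {x : V} {ι : Type (max u v)} [Finite ι] {y : ι → V}
      (T : ∀ i, RootedOver.{u, v, max u v} (y i)) (a : ∀ i, y i ⟶ x),
      (∀ i, P (T i)) → P (RootedOver.graft T a))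
    {x : V} (h : Acc ArrowRel x) : ∀ M : treeLattice h, P (treeReduced h M) := by
  induction h with
  | intro x h ih => exact fun M => graft _ _ fun i => ih i.1 ⟨i.2.1⟩ _

end Reduced

/-! ### Morphisms and simulations between quivers over a quiver -/

namespace RootedOver

variable {V : Type u} [Quiver.{v} V] {x x' : V}

/-- A morphism over `V` preserving roots. -/
structure Morphism (A : RootedOver.{u, v, w} x) (B : RootedOver.{u, v, w} x') where
  /-- The map on vertices. -/
  obj : A.Vert → B.Vert
  obj_root : obj A.root = B.root
  str_obj : ∀ s, B.str.obj (obj s) = A.str.obj s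
  exists_map : ∀ {s t : A.Vert} (b : s ⟶ t), ∃ c : obj s ⟶ obj t, B.str.map c ≍ A.str.map b

/-- A simulation: related vertices lie over the same vertex, and arrows into the first one lift
to arrows into the second one. -/
structure IsSimulation (A : RootedOver.{u, v, w} x) (B : RootedOver.{u, v, w} x')
    (R : A.Vert → B.Vert → Prop) : Prop where
  str_obj : ∀ {s : A.Vert} {p : B.Vert}, R s p → B.str.obj p = A.str.obj s
  lift : ∀ {s t : A.Vert} (b : s ⟶ t) {q : B.Vert}, R t q →
    ∃ (p : B.Vert) (c : p ⟶ q), B.str.map c ≍ A.str.map b ∧ R s p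

variable {ι ι' : Type w} [Finite ι] [Finite ι'] {y : ι → V} {y' : ι' → V}

/-- Morphisms between members of two families induce a morphism between the grafts. -/
def Morphism.graft (T : ∀ i, RootedOver.{u, v, w} (y i)) (a : ∀ i, y i ⟶ x)
    (T' : ∀ i, RootedOver.{u, v, w} (y' i)) (a' : ∀ i, y' i ⟶ x) (φ : ι → ι')
    (ha : ∀ i, a' (φ i) ≍ a i) (g : ∀ i, Morphism (T i) (T' (φ i))) :
    Morphism (RootedOver.graft T a) (RootedOver.graft T' a') where
  obj s := match s with
    | none => none
    | some ⟨i, s⟩ => some ⟨φ i, (g i).obj s⟩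
  obj_root := rfl
  str_obj s := match s with
    | none => rfl
    | some ⟨i, s⟩ => (g i).str_obj s
  exists_map {s t} b := by
    change GraftHom T s t at b
    cases b with
    | inner b =>
      obtain ⟨c, hc⟩ := (g _).exists_map b
      exact ⟨GraftHom.inner c, hc⟩
    | ext i =>
      -- The image of the root is the root only propositionally, so the head of the path is
      -- generalized before substituting.
      have key : ∀ p : (T' (φ i)).Vert, p = (T' (φ i)).root →
          ∃ c : GraftHom T' (some ⟨φ i, p⟩) none, (graftStr T' a').map c ≍ a i := by
        rintro _ rfl
        exact ⟨GraftHom.ext (φ i), (graftStr_map_ext_heq T' a' (φ i)).trans (ha i)⟩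
      obtain ⟨c, hc⟩ := key _ (g i).obj_root
      exact ⟨c, hc.trans (graftStr_map_ext_heq T a i).symm⟩

/-- A simulation between grafts that relates the roots restricts to simulations between members
of the two families. -/
theorem IsSimulation.of_graft {T : ∀ i, RootedOver.{u, v, w} (y i)} {a : ∀ i, y i ⟶ x}
    {T' : ∀ i, RootedOver.{u, v, w} (y' i)} {a' : ∀ i, y' i ⟶ x'}
    {R : GraftVert T → GraftVert T' → Prop}
    (hR : IsSimulation (RootedOver.graft T a) (RootedOver.graft T' a') R)
    (hroot : R none none) (i : ι) :
    ∃ j, y' j = y i ∧ a' j ≍ a i ∧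
      IsSimulation (T i) (T' j) (fun s p => R (some ⟨i, s⟩) (some ⟨j, p⟩)) ∧
      R (some ⟨i, (T i).root⟩) (some ⟨j, (T' j).root⟩) := by
  obtain ⟨p, c, hc, hp⟩ := hR.lift (s := some ⟨i, (T i).root⟩) (t := none) (GraftHom.ext i) hroot
  have hobj : (graftStr T' a').obj p = (T i).str.obj (T i).root := hR.str_obj hp
  change GraftHom T' p none at c
  -- Only the new arrows end at the common sink, so the lift selects a branch `j` and `p` is the
  -- root of `T' j`.
  cases c with
  | ext j =>
    refine ⟨j, ?_, ?_, ⟨fun h => hR.str_obj h, fun {s t} b q hq => ?_⟩, hp⟩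
    · exact (T' j).str_root.symm.trans (hobj.trans (T i).str_root)
    · exact (graftStr_map_ext_heq T' a' j).symm.trans (hc.trans (graftStr_map_ext_heq T a i))
    · obtain ⟨p, c, hc, hp⟩ := hR.lift (s := some ⟨i, s⟩) (t := some ⟨i, t⟩) (.inner b) hq
      change GraftHom T' p (some ⟨j, q⟩) at c
      -- An arrow ending inside branch `j` also starts there, so the simulation never leaves the
      -- branch.
      cases c with
      | inner c => exact ⟨_, c, hc, hp⟩

end RootedOver

section Reduced

variable {V : Type u} [Quiver.{v} V] [Finite V] [∀ x y : V, Finite (x ⟶ y)]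

open RootedOver

/-- Each maximal element of `M y a` lies below a maximal element of `N y a`; recursion maps the
corresponding branch of `Q_M` into one of `Q_N`. -/
theorem nonempty_morphism_treeReduced {x : V} (h : Acc ArrowRel x) : ∀ M N : treeLattice h,
    M ≤ N → Nonempty (Morphism (treeReduced h M) (treeReduced h N)) := by
  induction h with
  | intro x h ih =>
    intro (M : ∀ (y : V) (a : y ⟶ x), LowerSet (treeLattice (h y ⟨a⟩)))
      (N : ∀ (y : V) (a : y ⟶ x), LowerSet (treeLattice (h y ⟨a⟩)))
      (hMN : ∀ (y : V) (a : y ⟶ x), M y a ≤ N y a)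
    have hex : ∀ i : Σ y : V, Σ a : y ⟶ x,
        {S : treeLattice (h y ⟨a⟩) // Maximal (· ∈ M y a) S},
        ∃ S : {S : treeLattice (h i.1 ⟨i.2.1⟩) // Maximal (· ∈ N i.1 i.2.1) S},
          i.2.2.1 ≤ S.1 := by
      rintro ⟨y, a, S, hS⟩
      obtain ⟨S', hle, hmax⟩ := Finite.exists_le_maximal (p := (· ∈ N y a)) (hMN y a hS.prop)
      exact ⟨⟨S', hmax⟩, hle⟩
    choose j hj using hex
    exact ⟨Morphism.graft _ _ _ _ (fun i => ⟨i.1, i.2.1, j i⟩) (fun _ => HEq.rfl)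
      fun i => (ih i.1 ⟨i.2.1⟩ _ _ (hj i)).some⟩

/-- A simulation matches the branch of a maximal `S'` in `M y a` with that of some `T` in `N y a`;
by recursion `S' ≤ T`, so `S'` lies in the ideal `N y a`. -/
theorem le_of_isSimulation_treeReduced {x : V} (h : Acc ArrowRel x) :
    ∀ (M N : treeLattice h) (R : (treeReduced h M).Vert → (treeReduced h N).Vert → Prop),
      IsSimulation (treeReduced h M) (treeReduced h N) R →
      R (treeReduced h M).root (treeReduced h N).root → M ≤ N := by
  induction h with
  | intro x h ih =>
    intro (M : ∀ (y : V) (a : y ⟶ x), LowerSet (treeLattice (h y ⟨a⟩)))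
      (N : ∀ (y : V) (a : y ⟶ x), LowerSet (treeLattice (h y ⟨a⟩))) R hR hroot
    change ∀ (y : V) (a : y ⟶ x), M y a ≤ N y a
    intro y a S hS
    obtain ⟨S', hle, hmax⟩ := Finite.exists_le_maximal (p := (· ∈ M y a)) hS
    refine (N y a).lower hle ?_
    obtain ⟨⟨y', a', T, hT⟩, hy, ha, hsim, hr⟩ := IsSimulation.of_graft hR hroot ⟨y, a, S', hmax⟩
    dsimp only at hy ha
    subst hy
    obtain rfl := eq_of_heq ha
    exact (N y' a').lower (ih y' ⟨a'⟩ S' T _ hsim hr) hT.prop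

end Reduced

/-! ### Rank functions of reduced representations -/

namespace QuiverRep

section

variable {K : Type k} [Field K] {V' : Type u} [Quiver.{v} V'] [Finite V']
  [∀ s t : V', Finite (s ⟶ t)] {V : Type w} [Quiver.{w'} V]

theorem pushforward_map_apply.{r} (f : V' ⥤q V) (W : QuiverRep.{k, u, v, r} K V') {x y : V}
    (a : x ⟶ y) (e : ∀ s : {s : V' // f.obj s = x}, W.obj s) (t : {t : V' // f.obj t = y})
    [hF : Fintype
      (Σ s : {s : V' // f.obj s = x}, {b : s.1 ⟶ t.1 // (f.map b).cast s.2 t.2 = a})] :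
    (show ∀ t : {t : V' // f.obj t = y}, W.obj t from (pushforward f W).map a e) t =
      ∑ b : (Σ s : {s : V' // f.obj s = x}, {b : s.1 ⟶ t.1 // (f.map b).cast s.2 t.2 = a}),
        W.map b.2.1 (e b.1) := by
  obtain rfl : hF = Fintype.ofFinite _ := Subsingleton.elim _ _
  let := Fintype.ofFinite
    (Σ s : {s : V' // f.obj s = x}, {b : s.1 ⟶ t.1 // (f.map b).cast s.2 t.2 = a})
  change (∑ b : (Σ s : {s : V' // f.obj s = x}, {b : s.1 ⟶ t.1 // (f.map b).cast s.2 t.2 = a}),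
    W.map b.2.1 ∘ₗ LinearMap.proj (φ := fun s : {s : V' // f.obj s = x} => W.obj s) b.1) e = _
  rw [LinearMap.sum_apply]
  rfl

theorem pushforward_one_map_apply (f : V' ⥤q V) {x y : V} (a : x ⟶ y)
    (e : {s : V' // f.obj s = x} → K) (t : {t : V' // f.obj t = y}) [Fintype
      (Σ s : {s : V' // f.obj s = x}, {b : s.1 ⟶ t.1 // (f.map b).cast s.2 t.2 = a})] :
    (show {t : V' // f.obj t = y} → K from (pushforward f (one K V')).map a e) t =
      ∑ b : (Σ s : {s : V' // f.obj s = x}, {b : s.1 ⟶ t.1 // (f.map b).cast s.2 t.2 = a}),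
        e b.1 :=
  pushforward_map_apply f (one K V') a e t

/-- If `p` has a single outgoing arrow and it lies over `a`, then `f_* 𝟙` maps the basis vector of
`p` along `a` to the basis vector of the head of that arrow. -/
theorem pushforward_one_map_single [DecidableEq V'] (f : V' ⥤q V) {p q : V'}
    [Subsingleton (Σ t, p ⟶ t)]
    {x y : V} (a : x ⟶ y) (hp : f.obj p = x) (hq : f.obj q = y) (c : p ⟶ q)
    (hc : f.map c ≍ a) :
    (pushforward f (one K V')).map a
      (Pi.single (M := fun _ : {u : V' // f.obj u = x} => K) ⟨p, hp⟩ (1 : K)) =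
      Pi.single (M := fun _ : {u : V' // f.obj u = y} => K) ⟨q, hq⟩ (1 : K) := by
  funext t
  let := Fintype.ofFinite
    (Σ s : {s : V' // f.obj s = x}, {b : s.1 ⟶ t.1 // (f.map b).cast s.2 t.2 = a})
  refine (pushforward_one_map_apply f a
    (Pi.single ⟨p, hp⟩ 1 : {s : V' // f.obj s = x} → K) t).trans ?_
  change ∑ b : (Σ s : {s : V' // f.obj s = x}, {b : s.1 ⟶ t.1 // (f.map b).cast s.2 t.2 = a}),
    (Pi.single ⟨p, hp⟩ 1 : {s : V' // f.obj s = x} → K) b.1 =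
    (Pi.single ⟨q, hq⟩ 1 : {s : V' // f.obj s = y} → K) t
  by_cases ht : t = ⟨q, hq⟩
  · subst ht
    have hc' : (f.map c).cast hp hq = a := (Quiver.Hom.cast_eq_iff_heq _ _ _ _).2 hc
    rw [Pi.single_eq_same, Finset.sum_eq_single ⟨⟨p, hp⟩, c, hc'⟩]
    · exact Pi.single_eq_same _ _
    · rintro ⟨⟨s, hs⟩, b, hb⟩ - hne
      refine Pi.single_eq_of_ne ?_ _
      intro h
      obtain rfl : s = p := congrArg Subtype.val h
      have := Subsingleton.elim (⟨q, b⟩ : Σ t, s ⟶ t) ⟨q, c⟩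
      cases this
      exact hne rfl
    · simp
  · rw [Pi.single_eq_of_ne ht]
    refine Finset.sum_eq_zero ?_
    rintro ⟨⟨s, hs⟩, b, hb⟩ -
    refine Pi.single_eq_of_ne ?_ _
    intro h
    obtain rfl : s = p := congrArg Subtype.val h
    have := congrArg Sigma.fst (Subsingleton.elim (⟨t, b⟩ : Σ t, s ⟶ t) ⟨q, c⟩)
    exact ht (Subtype.ext this)

/-- A nonzero coordinate of the image needs a nonzero summand; this supplies the lifts of arrows in
a simulation. -/
theorem exists_ne_zero_of_pushforward_one_map (f : V' ⥤q V) {x y : V} (a : x ⟶ y)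
    (e : {s : V' // f.obj s = x} → K) (t : {t : V' // f.obj t = y})
    (h : (show {t : V' // f.obj t = y} → K from (pushforward f (one K V')).map a e) t ≠ 0) :
    ∃ (s : {s : V' // f.obj s = x}) (b : s.1 ⟶ t.1), f.map b ≍ a ∧ e s ≠ 0 := by
  let := Fintype.ofFinite
    (Σ s : {s : V' // f.obj s = x}, {b : s.1 ⟶ t.1 // (f.map b).cast s.2 t.2 = a})
  rw [pushforward_one_map_apply] at h
  obtain ⟨⟨s, b, hb⟩, -, hs⟩ := Finset.exists_ne_zero_of_sum_ne_zero h
  exact ⟨s, b, (Quiver.Hom.cast_eq_iff_heq _ _ _ _).1 hb, hs⟩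

end

end QuiverRep

namespace RootedOver

open QuiverRep

variable {K : Type k} [Field K] {V : Type u} [Quiver.{v} V] {x : V}

theorem ExtendsSubspaces.monoKer_root_eq_bot {A : RootedOver.{u, v, w} x}
    (hA : ExtendsSubspaces.{k, u, v, w, w'} K A) (W : QuiverRep.{k, w, w, w'} K A.Vert) :
    W.monoKer A.root = ⊥ := by
  obtain ⟨N, hroot, hN⟩ := hA W ⊥
  rw [eq_bot_iff, ← hroot]
  refine iInf₂_le_of_le (⟨N, fun b => Submodule.map_le_iff_le_comap.2 (hN b).ge⟩ : W.Subrep)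
    ?_ le_rfl
  intro s t b
  -- The kernel of the induced map is the image of `(N t).comap` in the quotient by `N s`; the two
  -- subspaces coincide.
  rw [← LinearMap.ker_eq_bot, Submodule.ker_mapQ, hN b]
  exact Submodule.mkQ_map_self _

/-- A nonzero epimorphic part at the root yields a simulation. -/
theorem exists_isSimulation_of_epiPart_ne_bot {A B : RootedOver.{u, v, w} x}
    (h : ((pushforward B.str (one K B.Vert)).pullback A.str).epiPart A.root ≠ ⊥)
    (hB : ∀ p : B.Vert, B.str.obj p = x → p = B.root) :
    ∃ R, IsSimulation A B R ∧ R A.root B.root := by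
  obtain ⟨E, hE, hne⟩ : ∃ E : ((pushforward B.str (one K B.Vert)).pullback A.str).Subrep,
      E.IsEpimorphic ∧ E.space A.root ≠ ⊥ := by
    by_contra! hcon
    exact h (by simpa [epiPart] using hcon)
  -- `s` is related to `p` when some vector of `E` at `s` has a nonzero coordinate at `p`;
  -- surjectivity of `E` along arrows gives the lifting.
  refine ⟨fun s p => ∃ hp : B.str.obj p = A.str.obj s,
    ∃ e : {u : B.Vert // B.str.obj u = A.str.obj s} → K, e ∈ E.space s ∧ e ⟨p, hp⟩ ≠ 0,
    ⟨fun h => h.1, ?_⟩, ?_⟩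
  · rintro s t b q ⟨hq, e, he, hne⟩
    rw [← hE b] at he
    obtain ⟨e', he', rfl⟩ := he
    obtain ⟨⟨p, hp⟩, c, hc, hpe⟩ :=
      exists_ne_zero_of_pushforward_one_map B.str (A.str.map b) e' ⟨q, hq⟩ hne
    exact ⟨p, c, hc, hp, e', he', hpe⟩
  · obtain ⟨e, he, hne⟩ := Submodule.exists_mem_ne_zero_of_ne_bot hne
    obtain ⟨⟨p, hp⟩, hpe⟩ := Function.ne_iff.1 hne
    obtain rfl := hB p (hp.trans A.str_root)
    exact ⟨hp, e, he, hpe⟩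

/-- A morphism makes the epimorphic part at the root contain the basis vector of the root. -/
theorem Morphism.single_mem_epiPart {A B : RootedOver.{u, v, w} x} [DecidableEq B.Vert]
    (g : Morphism A B) (hB : ∀ s : B.Vert, Subsingleton (Σ t : B.Vert, s ⟶ t)) :
    (Pi.single (M := fun _ : {u : B.Vert // B.str.obj u = A.str.obj A.root} => K)
      ⟨g.obj A.root, g.str_obj _⟩ (1 : K)) ∈
      ((pushforward B.str (one K B.Vert)).pullback A.str).epiPart A.root := by
  let F : ∀ s : A.Vert, ((pushforward B.str (one K B.Vert)).pullback A.str).obj s := fun s =>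
    Pi.single (M := fun _ : {u : B.Vert // B.str.obj u = A.str.obj s} => K)
      ⟨g.obj s, g.str_obj s⟩ (1 : K)
  -- Each basis vector goes to the next one because vertices of `B` have at most one outgoing arrow,
  -- so these lines form an epimorphic subrepresentation.
  have hF : ∀ {s t : A.Vert} (b : s ⟶ t), (K ∙ F s).map
      (((pushforward B.str (one K B.Vert)).pullback A.str).map b) = K ∙ F t := by
    intro s t b
    obtain ⟨c, hc⟩ := g.exists_map b
    rw [Submodule.map_span, Set.image_singleton]
    have := hB (g.obj s)
    exact congrArg (fun v => K ∙ v)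
      (pushforward_one_map_single B.str (A.str.map b) (g.str_obj s) (g.str_obj t) c hc)
  exact (le_iSup₂_of_le (f := fun (E : ((pushforward B.str (one K B.Vert)).pullback A.str).Subrep)
    (_ : E.IsEpimorphic) => E.space A.root) ⟨fun s => K ∙ F s, fun b => (hF b).le⟩ hF le_rfl)
    (Submodule.mem_span_singleton_self (F A.root))

end RootedOver

section Reduced

variable {V : Type u} [Quiver.{v} V] [Finite V] [∀ x y : V, Finite (x ⟶ y)]

open RootedOver QuiverRep

namespace IsRootedTree

variable {K : Type k} [Field K] {σ : V} (hQ : IsRootedTree σ) {x : V} (M N : hQ.latt x)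

theorem isForestTowardsRoot_reduced : (hQ.reduced M).IsForestTowardsRoot :=
  treeReduced_induction (P := fun A => A.IsForestTowardsRoot) .graft _ M

theorem monoKer_root_reduced (W : QuiverRep.{k, _, _, w} K (hQ.reduced M).Vert) :
    W.monoKer (hQ.reduced M).root = ⊥ :=
  (treeReduced_induction (P := ExtendsSubspaces.{k, u, v, max u v, w} K) (.graft K) _
    M).monoKer_root_eq_bot W

/-- Any other vertex over `x` would give a directed cycle through `x`. -/
theorem eq_root_of_str_obj_eq {p : (hQ.reduced N).Vert} (hp : (hQ.reduced N).str.obj p = x) :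
    p = (hQ.reduced N).root := by
  refine (treeReduced_induction (P := LiesOverPaths) .graft _ N p).resolve_right fun h => ?_
  rw [show (treeReduced (hQ.acc x) N).str.obj p = x from hp] at h
  exact hQ.not_transGen_self x h

theorem rankFunction_reducedRep_of_not_le (h : ¬ M ≤ N) :
    hQ.rankFunction M (hQ.reducedRep K N) = 0 := by
  have hbot : ((hQ.reducedRep K N).pullback (hQ.reduced M).str).epiPart
      (hQ.reduced M).root = ⊥ := by
    by_contra hne
    obtain ⟨R, hR, hroot⟩ := exists_isSimulation_of_epiPart_ne_bot hne
      fun _ => hQ.eq_root_of_str_obj_eq N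
    exact h (le_of_isSimulation_treeReduced _ M N R hR hroot)
  rw [rankFunction, rankSpace, globalRank, hbot, Submodule.map_bot, finrank_bot]

theorem rankFunction_reducedRep_of_le (h : M ≤ N) :
    hQ.rankFunction M (hQ.reducedRep K N) = 1 := by
  classical
  obtain ⟨g⟩ := nonempty_morphism_treeReduced _ M N h
  have hmem := g.single_mem_epiPart (K := K) (hQ.isForestTowardsRoot_reduced N).subsingleton_out
  -- The fibre over `x` is a single point, so the one basis vector in the epimorphic part spans the
  -- whole space.
  let : Unique {u : (hQ.reduced N).Vert //
      (hQ.reduced N).str.obj u = (hQ.reduced M).str.obj (hQ.reduced M).root} :=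
    { default := ⟨g.obj (hQ.reduced M).root, g.str_obj _⟩
      uniq := fun p => Subtype.ext <|
        (hQ.eq_root_of_str_obj_eq N (p.2.trans (hQ.reduced M).str_root)).trans g.obj_root.symm }
  have hspan : ∀ v : {u : (hQ.reduced N).Vert //
      (hQ.reduced N).str.obj u = (hQ.reduced M).str.obj (hQ.reduced M).root} → K,
      v = v default • Pi.single default 1 := by
    intro v
    funext p
    rw [Unique.eq_default p]
    simp
  have htop : ((hQ.reducedRep K N).pullback (hQ.reduced M).str).epiPart
      (hQ.reduced M).root = ⊤ := by
    rw [eq_top_iff]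
    intro v _
    have hv := Submodule.smul_mem _ ((show {u : (hQ.reduced N).Vert //
      (hQ.reduced N).str.obj u = (hQ.reduced M).str.obj (hQ.reduced M).root} → K from v) default)
      hmem
    exact (hspan v).symm ▸ hv
  rw [rankFunction, rankSpace, globalRank, htop, Submodule.map_top, Submodule.range_mkQ,
    finrank_top, (Submodule.quotEquivOfEqBot _ (hQ.monoKer_root_reduced M _)).finrank_eq]
  exact (Module.finrank_fintype_fun_eq_card K (η := {u : (hQ.reduced N).Vert //
      (hQ.reduced N).str.obj u = (hQ.reduced M).str.obj (hQ.reduced M).root})).trans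
    Fintype.card_unique

end IsRootedTree

end Reduced

theorem corollary3 {K : Type k} [Field K] {V : Type u} [Quiver.{v} V] [Finite V]
    [∀ x y : V, Finite (x ⟶ y)] {σ : V} (hQ : IsRootedTree σ) (x : V) (M N : hQ.latt x) :
    (hQ.rankFunction M (hQ.reducedRep K N) : ℤ) = IncidenceAlgebra.zeta ℤ M N ∧
    (M ≤ N → hQ.rankFunction M (hQ.reducedRep K N) = 1) ∧
    (¬ M ≤ N → hQ.rankFunction M (hQ.reducedRep K N) = 0) := by
  refine ⟨?_, hQ.rankFunction_reducedRep_of_le M N, hQ.rankFunction_reducedRep_of_not_le M N⟩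
  rw [IncidenceAlgebra.zeta_apply]
  split_ifs with h
  · rw [hQ.rankFunction_reducedRep_of_le M N h, Nat.cast_one]
  · rw [hQ.rankFunction_reducedRep_of_not_le M N h, Nat.cast_zero]
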